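/- Let $B_n$ be the Bernoulli numbers, $\frac{t}{e^t-1}=\sum_{n\ge0}B_n\frac{t^n}{n!}$ (so $B_1=-\tfrac12$), and let $E_n=E_n(0)$ be the value at $0$ of the $n$-th Euler polynomial, where $\frac{2e^{xt}}{e^t+1}=\sum_{n\ge0}E_n(x)\frac{t^n}{n!}$. For rational numbers $a,b$ and a prime $p$, write $a\equiv b\pmod p$ if $a-b=pc$ for some rational number $c$ whose denominator in lowest terms is not divisible by $p$. Then for every odd prime $p$: $$\sum_{j=0}^{p}pB_j\equiv-1\pmod p,$$ $$\sum_{j=0}^{p-3}B_j\equiv-1\pmod p\quad\text{if }p\ge5,$$ $$\sum_{j=0}^{p}E_j\equiv\frac32\pmod p,$$ $$p\sum_{j=0}^{p}\frac{B_j}{p-j+1}\equiv-1\pmod p.$$ -/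

import Mathlib

/-- The exponential generating function `2 * exp (x * t) / (exp t + 1)` of the Euler polynomials,
as a formal power series in `t` over `ℚ[x]`. The constant coefficient of `exp t + 1` is `2 ≠ 0`,
so the inverse is the inverse of a unit of `ℚ⟦t⟧`. -/
noncomputable def eulerGenFun : PowerSeries (Polynomial ℚ) :=
  PowerSeries.map Polynomial.C (2 * (PowerSeries.exp ℚ + 1)⁻¹) *
    PowerSeries.rescale (Polynomial.X : Polynomial ℚ) (PowerSeries.exp (Polynomial ℚ))

/-- The `n`-th Euler polynomial `E_n(x)`: `∑ E_n(x) t ^ n / n! = 2 * exp (x * t) / (exp t + 1)`. -/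
noncomputable def eulerPoly (n : ℕ) : Polynomial ℚ :=
  (n.factorial : Polynomial ℚ) * PowerSeries.coeff n eulerGenFun

/-- The `n`-th Euler number in the convention `E_n = E_n(0)`. -/
noncomputable def eulerNumber (n : ℕ) : ℚ :=
  (eulerPoly n).eval 0

/-- Congruence of rational numbers modulo `m`: the difference is `m` times a rational number whose
denominator (in lowest terms) is coprime to `m`. -/
def RatModEq (m : ℕ) (a b : ℚ) : Prop :=
  ∃ c : ℚ, Nat.Coprime c.den m ∧ a - b = (m : ℚ) * c

/-! Everything follows from two recurrences, ∑_{k<n} C(n,k) B_k = 0 for n > 1 and ∑_{k≤n} C(n,k) E_k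
+ E_n = 0 for n > 0. At n = p the inner binomials vanish mod p, giving p B_{p-1} ≡ -1 and E_p ≡
-1/2. At n = p-1 they become (-1)^k, giving alternating sums; as B_k = 0 for odd k > 1 and E_k = 0
for even k > 0, these determine the plain sums. -/

open Finset

/-! ### Congruences over the `p`-integral rationals -/

section PIntegral

variable {p : ℕ} [Fact p.Prime]

/-- The subring of `ℚ` of the rational numbers whose denominator is not divisible by `p`. -/
noncomputable abbrev pIntegralSubring (p : ℕ) [Fact p.Prime] : Subring ℚ :=
  (Rat.padicValuation p).integer

lemma mem_pIntegralSubring_iff {x : ℚ} : x ∈ pIntegralSubring p ↔ x.den.Coprime p := by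
  rw [Valuation.mem_integer_iff, Rat.padicValuation_le_one_iff, Nat.coprime_comm,
    (Fact.out : p.Prime).coprime_iff_not_dvd]

lemma inv_natCast_mem_pIntegralSubring {n : ℕ} (hn : ¬ p ∣ n) :
    (n : ℚ)⁻¹ ∈ pIntegralSubring p := by
  have h0 : n ≠ 0 := by rintro rfl; simp at hn
  rw [Valuation.mem_integer_iff, Rat.padicValuation_le_one_iff, Rat.inv_natCast_den,
    if_neg h0]
  exact hn

lemma inv_natCast_mem_of_pos_of_lt {n : ℕ} (h0 : 0 < n) (hn : n < p) :
    (n : ℚ)⁻¹ ∈ pIntegralSubring p :=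
  inv_natCast_mem_pIntegralSubring (Nat.not_dvd_of_pos_of_lt h0 hn)

lemma ratModEq_iff {a b : ℚ} :
    RatModEq p a b ↔ ∃ c ∈ pIntegralSubring p, a - b = p * c := by
  simp only [RatModEq, mem_pIntegralSubring_iff]

namespace RatModEq

variable {a b c d : ℚ}

lemma of_sub_eq (h : c ∈ pIntegralSubring p) (e : a - b = p * c) : RatModEq p a b :=
  ratModEq_iff.2 ⟨c, h, e⟩

lemma of_eq (h : a = b) : RatModEq p a b :=
  of_sub_eq (zero_mem _) (by simp [h])

lemma prime_mul (h : a ∈ pIntegralSubring p) : RatModEq p (p * a) 0 :=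
  of_sub_eq h (by ring)

lemma symm (h : RatModEq p a b) : RatModEq p b a := by
  obtain ⟨x, hx, e⟩ := ratModEq_iff.1 h
  exact of_sub_eq (neg_mem hx) (by linear_combination -e)

lemma add (h : RatModEq p a b) (h' : RatModEq p c d) : RatModEq p (a + c) (b + d) := by
  obtain ⟨x, hx, e⟩ := ratModEq_iff.1 h
  obtain ⟨y, hy, e'⟩ := ratModEq_iff.1 h'
  exact of_sub_eq (add_mem hx hy) (by linear_combination e + e')

lemma trans (h : RatModEq p a b) (h' : RatModEq p b c) : RatModEq p a c := by
  obtain ⟨x, hx, e⟩ := ratModEq_iff.1 h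
  obtain ⟨y, hy, e'⟩ := ratModEq_iff.1 h'
  exact of_sub_eq (add_mem hx hy) (by linear_combination e + e')

lemma mul_right (h : RatModEq p a b) (hc : c ∈ pIntegralSubring p) :
    RatModEq p (a * c) (b * c) := by
  obtain ⟨x, hx, e⟩ := ratModEq_iff.1 h
  exact of_sub_eq (mul_mem hx hc) (by linear_combination c * e)

lemma neg (h : RatModEq p a b) : RatModEq p (-a) (-b) := by
  obtain ⟨x, hx, e⟩ := ratModEq_iff.1 h
  exact of_sub_eq (neg_mem hx) (by linear_combination -e)

lemma sum {ι : Type*} {s : Finset ι} {f g : ι → ℚ} (h : ∀ i ∈ s, RatModEq p (f i) (g i)) :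
    RatModEq p (∑ i ∈ s, f i) (∑ i ∈ s, g i) := by
  choose! x hx e using fun i hi ↦ ratModEq_iff.1 (h i hi)
  refine of_sub_eq (sum_mem hx) ?_
  rw [← sum_sub_distrib, mul_sum]
  exact sum_congr rfl e

lemma sum_zero {ι : Type*} {s : Finset ι} {f : ι → ℚ} (h : ∀ i ∈ s, RatModEq p (f i) 0) :
    RatModEq p (∑ i ∈ s, f i) 0 := by
  simpa using sum h

end RatModEq

lemma ratModEq_choose_prime_mul {j : ℕ} (h0 : 0 < j) (hj : j < p) {a : ℚ}
    (ha : a ∈ pIntegralSubring p) : RatModEq p (p.choose j * a) 0 := by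
  obtain ⟨m, hm⟩ := (Fact.out : p.Prime).dvd_choose_self h0.ne' hj
  rw [hm, Nat.cast_mul, mul_assoc]
  exact .prime_mul (mul_mem (natCast_mem _ m) ha)

/-- Pascal's rule and `p ∣ p.choose (j + 1)` make consecutive entries of row `p - 1` opposite mod
`p`. -/
lemma ratModEq_choose_prime_sub_one {j : ℕ} (hj : j < p) :
    RatModEq p ((p - 1).choose j) ((-1) ^ j) := by
  induction j with
  | zero => exact .of_eq (by simp)
  | succ j ih =>
    have h := ratModEq_choose_prime_mul j.succ_pos hj (one_mem _)
    have hpas : p.choose (j + 1) = (p - 1).choose j + (p - 1).choose (j + 1) := by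
      obtain ⟨q, rfl⟩ : ∃ q, p = q + 1 := ⟨p - 1, by omega⟩
      exact Nat.choose_succ_succ q j
    have := h.add (ih (by omega)).neg
    rw [hpas] at this
    convert this using 1 <;> push_cast <;> ring

/-! ### Bernoulli numbers -/

/-- The Bernoulli numbers below index `p - 1` are `p`-integral. -/
lemma bernoulli_mem_pIntegralSubring {j : ℕ} (hj : j + 1 < p) :
    bernoulli j ∈ pIntegralSubring p := by
  induction j using Nat.strong_induction_on with
  | _ j ih =>
    rcases Nat.eq_zero_or_pos j with rfl | h0
    · simp
    have h := sum_bernoulli (j + 1)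
    rw [sum_range_succ, if_neg (by omega), Nat.choose_succ_self_right] at h
    have hne : ((j + 1 : ℕ) : ℚ) ≠ 0 := by positivity
    have : bernoulli j =
        -(∑ k ∈ range j, ((j + 1).choose k : ℚ) * bernoulli k) * ((j + 1 : ℕ) : ℚ)⁻¹ := by
      field_simp
      linear_combination h
    rw [this]
    refine mul_mem (neg_mem (sum_mem fun k hk ↦ mul_mem (natCast_mem _ _) (ih k ?_ ?_)))
      (inv_natCast_mem_of_pos_of_lt j.succ_pos hj)
    all_goals have := mem_range.1 hk; omega

/-- The prime `p` itself has `p * B_{p-1} ≡ -1`. -/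
lemma ratModEq_prime_mul_bernoulli_sub_one :
    RatModEq p (p * bernoulli (p - 1)) (-1) := by
  have h2 := (Fact.out : p.Prime).two_le
  obtain ⟨q, rfl⟩ : ∃ q, p = q + 1 + 1 := ⟨p - 2, by omega⟩
  have h := sum_bernoulli (q + 1 + 1)
  rw [sum_range_succ, if_neg (by omega), Nat.choose_succ_self_right, sum_range_succ'] at h
  have hs : RatModEq (q + 1 + 1) (∑ k ∈ range q,
      (((q + 1 + 1).choose (k + 1) : ℕ) : ℚ) * bernoulli (k + 1)) 0 :=
    .sum_zero fun k hk ↦ by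
      have := mem_range.1 hk
      exact ratModEq_choose_prime_mul k.succ_pos (by omega)
        (bernoulli_mem_pIntegralSubring (by omega))
  have := hs.neg.add (.of_eq (rfl : (-1 : ℚ) = -1))
  simp only [Nat.choose_zero_right, bernoulli_zero, Nat.cast_one, mul_one] at h
  convert this using 1
  · simp only [Nat.add_sub_cancel]
    linear_combination h
  · simp

/-- The alternating sum over a range of a sequence vanishing at even positive indices. -/
lemma sum_range_eq_neg_alternating {f : ℕ → ℚ} (hf : ∀ n, Even n → 0 < n → f n = 0) (n : ℕ) :
    ∑ k ∈ range (n + 1), f k = 2 * f 0 - ∑ k ∈ range (n + 1), (-1) ^ k * f k := by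
  induction n with
  | zero => simp; ring
  | succ n ih =>
    rw [sum_range_succ, ih, sum_range_succ _ (n + 1)]
    rcases Nat.even_or_odd (n + 1) with h | h
    · rw [hf _ h n.succ_pos]; ring
    · rw [h.neg_one_pow]; ring

/-- The alternating sum over a range of a sequence vanishing at odd indices above `1`. -/
lemma sum_range_eq_alternating {f : ℕ → ℚ} (hf : ∀ n, Odd n → 1 < n → f n = 0) (n : ℕ) :
    ∑ k ∈ range (n + 2), f k = 2 * f 1 + ∑ k ∈ range (n + 2), (-1) ^ k * f k := by
  induction n with
  | zero => simp [sum_range_succ]; ring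
  | succ n ih =>
    rw [sum_range_succ, ih, sum_range_succ _ (n + 2)]
    rcases Nat.even_or_odd (n + 2) with h | h
    · rw [h.neg_one_pow]; ring
    · rw [hf _ h (by omega)]; ring

/-- The recurrence at `p - 1` makes the alternating sum vanish mod `p`; the plain sum differs from
it by 2 B_1 = -1. -/
lemma ratModEq_sum_bernoulli (h5 : 5 ≤ p) (hodd : Odd p) :
    RatModEq p (∑ j ∈ range (p - 2), bernoulli j) (-1) := by
  have h := sum_bernoulli (p - 1)
  rw [if_neg (by omega)] at h
  have hc : RatModEq p (∑ k ∈ range (p - 1), ((p - 1).choose k : ℚ) * bernoulli k)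
      (∑ k ∈ range (p - 1), (-1) ^ k * bernoulli k) := .sum fun k hk ↦ by
    have := mem_range.1 hk
    exact (ratModEq_choose_prime_sub_one (by omega)).mul_right
      (bernoulli_mem_pIntegralSubring (by omega))
  rw [h] at hc
  have ha := sum_range_eq_alternating (fun n ↦ bernoulli_eq_zero_of_odd (n := n)) (p - 3)
  obtain ⟨q, rfl⟩ : ∃ q, p = q + 3 := ⟨p - 3, by omega⟩
  simp only [Nat.add_sub_cancel, show q + 3 - 1 = q + 2 by omega,
    show q + 3 - 2 = q + 1 by omega] at *
  -- This is B_{p-2}, the last term of the recurrence; its index is odd and exceeds 1 because p ≥ 5.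
  have hz : bernoulli (q + 1) = 0 := bernoulli_eq_zero_of_odd (by grind) (by omega)
  have := hc.symm.add (.of_eq (rfl : (-1 : ℚ) = -1))
  convert this using 1
  · rw [sum_range_succ, hz, bernoulli_one] at ha
    linear_combination ha
  · simp

lemma ratModEq_sum_prime_mul_bernoulli (hodd : Odd p) :
    RatModEq p (∑ j ∈ range (p + 1), (p : ℚ) * bernoulli j) (-1) := by
  have h2 := (Fact.out : p.Prime).two_le
  have hp : bernoulli p = 0 := bernoulli_eq_zero_of_odd hodd (by omega)
  have hs : RatModEq p (∑ j ∈ range (p - 1), (p : ℚ) * bernoulli j) 0 :=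
    .sum_zero fun k hk ↦ by
      have := mem_range.1 hk
      exact .prime_mul (bernoulli_mem_pIntegralSubring (by omega))
  have := hs.add ratModEq_prime_mul_bernoulli_sub_one
  rw [← sum_range_succ, Nat.sub_add_cancel (by omega)] at this
  rw [sum_range_succ, hp]
  simpa using this

/-- Two terms survive, each contributing -1/2: j = 1, where the denominator p cancels the outer
factor, and j = p-1, with denominator 2. -/
lemma ratModEq_prime_mul_sum_bernoulli_div (hodd : Odd p) :
    RatModEq p ((p : ℚ) * ∑ j ∈ range (p + 1), bernoulli j / ((p : ℚ) - (j : ℚ) + 1)) (-1) := by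
  have h2 := (Fact.out : p.Prime).two_le
  have h3 : 3 ≤ p := by grind
  have hp : bernoulli p = 0 := bernoulli_eq_zero_of_odd hodd (by omega)
  have hhalf : (2 : ℚ)⁻¹ ∈ pIntegralSubring p :=
    mod_cast inv_natCast_mem_of_pos_of_lt (p := p) two_pos (show 2 < p from h3)
  have hlast := (ratModEq_prime_mul_bernoulli_sub_one (p := p)).mul_right hhalf
  have hfirst : RatModEq p ((p : ℚ) * ((p + 1 : ℕ) : ℚ)⁻¹) 0 :=
    .prime_mul (inv_natCast_mem_pIntegralSubring
      fun h ↦ by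
      have := Nat.le_of_dvd one_pos ((Nat.dvd_add_right (dvd_refl p)).1 h)
      omega)
  have hs : RatModEq p (∑ j ∈ range (p - 3),
      (p : ℚ) * (bernoulli (j + 2) * ((p - (j + 2) + 1 : ℕ) : ℚ)⁻¹)) 0 :=
    .sum_zero fun k hk ↦ by
      have := mem_range.1 hk
      exact .prime_mul (mul_mem (bernoulli_mem_pIntegralSubring (by omega))
        (inv_natCast_mem_of_pos_of_lt (by omega) (by omega)))
  have key := (hs.add ((hfirst.add hlast))).add (.of_eq (rfl : (-1/2 : ℚ) = -1/2))
  obtain ⟨q, rfl⟩ : ∃ q, p = q + 3 := ⟨p - 3, by omega⟩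
  have hq : ((q : ℚ) + 3) ≠ 0 := by positivity
  convert key using 1
  · rw [sum_range_succ, hp, sum_range_succ, sum_range_succ', sum_range_succ', mul_add, mul_add,
      mul_add, mul_add, mul_sum, bernoulli_zero, bernoulli_one]
    simp only [Nat.add_sub_cancel, show q + 3 - 1 = q + 2 by omega]
    have : ∑ j ∈ range q, ((q + 3 : ℕ) : ℚ) * (bernoulli (j + 1 + 1) /
          (((q + 3 : ℕ) : ℚ) - ((j + 1 + 1 : ℕ) : ℚ) + 1)) =
        ∑ j ∈ range q, ((q + 3 : ℕ) : ℚ) *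
          (bernoulli (j + 2) * ((q + 3 - (j + 2) + 1 : ℕ) : ℚ)⁻¹) := by
      refine sum_congr rfl fun k hk ↦ ?_
      have := mem_range.1 hk
      rw [Nat.cast_add (q + 3 - (k + 2)), Nat.cast_sub (by omega), div_eq_mul_inv, Nat.cast_one]
    rw [this]
    push_cast [zero_add]
    have h1 : (q : ℚ) + 3 - 1 + 1 = q + 3 := by ring
    have h2 : (q : ℚ) + 3 - (q + 2) + 1 = 2 := by ring
    have h3 : ((q : ℚ) + 3) * (-1 / 2 / (q + 3)) = -1 / 2 := mul_div_cancel₀ _ hq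
    rw [h1, h2]
    linear_combination h3
  · norm_num

end PIntegral

/-! ### Euler numbers -/

section Euler

open PowerSeries

lemma map_eval_zero_eulerGenFun :
    PowerSeries.map (Polynomial.evalRingHom (0 : ℚ)) eulerGenFun = 2 * (exp ℚ + 1)⁻¹ := by
  have h : PowerSeries.map (Polynomial.evalRingHom (0 : ℚ))
      (rescale (Polynomial.X : Polynomial ℚ) (exp (Polynomial ℚ))) = 1 := by
    ext n
    simp only [coeff_map, coeff_rescale, coeff_exp, coeff_one, map_mul, map_pow,
      Polynomial.coe_evalRingHom, Polynomial.eval_X]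
    rcases n with _ | n <;> simp
  rw [eulerGenFun, map_mul, h, mul_one]
  ext n
  rw [coeff_map, coeff_map, Polynomial.coe_evalRingHom, Polynomial.eval_C]

lemma eulerNumber_eq_coeff (n : ℕ) :
    eulerNumber n = n.factorial * coeff n (2 * (exp ℚ + 1)⁻¹) := by
  rw [← map_eval_zero_eulerGenFun, eulerNumber, eulerPoly]
  simp

lemma constantCoeff_exp_add_one_ne_zero : constantCoeff (exp ℚ + 1) ≠ 0 := by
  norm_num

lemma two_mul_inv_exp_add_one_mul :
    (2 * (exp ℚ + 1)⁻¹) * (exp ℚ + 1) = 2 := by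
  rw [mul_assoc, PowerSeries.inv_mul_cancel _ constantCoeff_exp_add_one_ne_zero, mul_one]

/-- The recurrence of the Euler numbers. -/
lemma sum_choose_mul_eulerNumber (n : ℕ) :
    ∑ k ∈ range (n + 1), (n.choose k : ℚ) * eulerNumber k + eulerNumber n =
      if n = 0 then 2 else 0 := by
  have h := congrArg (fun f ↦ (n.factorial : ℚ) * coeff n f) two_mul_inv_exp_add_one_mul
  simp only [mul_add, mul_one, map_add, coeff_mul (n := n) (2 * (exp ℚ + 1)⁻¹),
    ← eulerNumber_eq_coeff] at h
  rw [Nat.sum_antidiagonal_eq_sum_range_succ_mk, mul_sum] at h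
  have h2 : (n.factorial : ℚ) * coeff n (2 : ℚ⟦X⟧) = if n = 0 then 2 else 0 := by
    rw [show (2 : ℚ⟦X⟧) = C (2 : ℚ) from (map_ofNat C 2).symm, coeff_C]
    split_ifs with h <;> simp [h]
  rw [← h2, ← h]
  congr 1
  refine sum_congr rfl fun k hk ↦ ?_
  have hk : k ≤ n := Nat.lt_succ_iff.1 (mem_range.1 hk)
  rw [eulerNumber_eq_coeff, Nat.cast_choose ℚ hk, coeff_exp]
  have := Nat.factorial_ne_zero k
  have := Nat.factorial_ne_zero (n - k)
  simp
  field_simp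

lemma eulerNumber_zero : eulerNumber 0 = 1 := by
  have := sum_choose_mul_eulerNumber 0
  simp at this
  linarith

/-- The Euler numbers `E_n(0)` of positive even index vanish. -/
lemma eulerNumber_eq_zero_of_even {n : ℕ} (hn : Even n) (h0 : 0 < n) : eulerNumber n = 0 := by
  set F : ℚ⟦X⟧ := 2 * (exp ℚ + 1)⁻¹ with hF
  have h := two_mul_inv_exp_add_one_mul
  have h' := congrArg evalNegHom h
  rw [← hF, map_mul, map_add, map_one, map_ofNat] at h'
  have hexp := exp_mul_exp_neg_eq_one (A := ℚ)
  have hne : exp ℚ + 1 ≠ 0 := fun e ↦ constantCoeff_exp_add_one_ne_zero (by rw [e]; simp)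
  -- F(-t) + F(t) = 2 is checked after multiplying by e^t + 1, using e^t (e^{-t} + 1) = e^t + 1.
  have hsum : evalNegHom F + F = 2 := by
    refine mul_right_cancel₀ hne ?_
    linear_combination exp ℚ * h' - evalNegHom F * hexp + h
  have hc := congrArg (coeff n) hsum
  rw [map_add, evalNegHom, coeff_rescale, hn.neg_one_pow,
    show (2 : ℚ⟦X⟧) = C (2 : ℚ) from (map_ofNat C 2).symm, coeff_C, if_neg h0.ne'] at hc
  rw [eulerNumber_eq_coeff, ← hF, show coeff n F = 0 by linarith, mul_zero]

variable {p : ℕ} [Fact p.Prime]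

lemma eulerNumber_mem_pIntegralSubring (hodd : Odd p) (n : ℕ) :
    eulerNumber n ∈ pIntegralSubring p := by
  induction n using Nat.strong_induction_on with
  | _ n ih =>
    rcases Nat.eq_zero_or_pos n with rfl | h0
    · simp [eulerNumber_zero]
    have h2 := (Fact.out : p.Prime).two_le
    have h3 : 2 < p := by grind
    have hhalf : (2 : ℚ)⁻¹ ∈ pIntegralSubring p :=
      mod_cast inv_natCast_mem_of_pos_of_lt (p := p) two_pos h3
    have h := sum_choose_mul_eulerNumber n
    rw [sum_range_succ, if_neg h0.ne', Nat.choose_self] at h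
    -- E_n occurs twice in the recurrence, so 2 is the only denominator.
    have : eulerNumber n = -(∑ k ∈ range n, (n.choose k : ℚ) * eulerNumber k) * 2⁻¹ := by
      push_cast at h
      linear_combination h / 2
    rw [this]
    exact mul_mem (neg_mem (sum_mem fun k hk ↦ mul_mem (natCast_mem _ _)
      (ih k (mem_range.1 hk)))) hhalf

/-- The Euler number of prime index `p` has `E_p ≡ -1/2`. -/
lemma ratModEq_eulerNumber_prime (hodd : Odd p) : RatModEq p (eulerNumber p) (-1 / 2) := by
  have h2 := (Fact.out : p.Prime).two_le
  have h3 : 2 < p := by grind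
  have hhalf : (2 : ℚ)⁻¹ ∈ pIntegralSubring p :=
    mod_cast inv_natCast_mem_of_pos_of_lt (p := p) two_pos h3
  have h := sum_choose_mul_eulerNumber p
  obtain ⟨q, rfl⟩ : ∃ q, p = q + 1 := ⟨p - 1, by omega⟩
  rw [sum_range_succ, sum_range_succ', if_neg (by omega), Nat.choose_self,
    Nat.choose_zero_right, eulerNumber_zero] at h
  have hs : RatModEq (q + 1) (∑ k ∈ range q,
      (((q + 1).choose (k + 1) : ℕ) : ℚ) * eulerNumber (k + 1)) 0 :=
    .sum_zero fun k hk ↦ by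
      have := mem_range.1 hk
      exact ratModEq_choose_prime_mul k.succ_pos (by omega)
        (eulerNumber_mem_pIntegralSubring hodd _)
  convert (hs.neg.add (.of_eq (rfl : (-1 : ℚ) = -1))).mul_right hhalf using 1
  · push_cast at h ⊢
    linear_combination h / 2
  · norm_num

/-- The sum up to p-1 is 2 E_0 minus an alternating sum ≡ 0; adding E_p ≡ -1/2 leaves 3/2. -/
lemma ratModEq_sum_eulerNumber (hodd : Odd p) :
    RatModEq p (∑ j ∈ range (p + 1), eulerNumber j) (3 / 2) := by
  have h2 := (Fact.out : p.Prime).two_le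
  have h3 : 2 < p := by grind
  have hev : Even (p - 1) := by grind
  have h := sum_choose_mul_eulerNumber (p - 1)
  rw [if_neg (by omega), eulerNumber_eq_zero_of_even hev (by omega), add_zero] at h
  have hc : RatModEq p (∑ k ∈ range (p - 1 + 1), ((p - 1).choose k : ℚ) * eulerNumber k)
      (∑ k ∈ range (p - 1 + 1), (-1) ^ k * eulerNumber k) := .sum fun k hk ↦ by
    have := mem_range.1 hk
    exact (ratModEq_choose_prime_sub_one (by omega)).mul_right
      (eulerNumber_mem_pIntegralSubring hodd _)
  rw [h] at hc
  have ha := sum_range_eq_neg_alternating (fun n ↦ eulerNumber_eq_zero_of_even (n := n)) (p - 1)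
  have key := (hc.symm.neg.add (.of_eq (rfl : (2 : ℚ) = 2))).add (ratModEq_eulerNumber_prime hodd)
  rw [Nat.sub_add_cancel (by omega)] at ha key
  convert key using 1
  · rw [sum_range_succ, ha, eulerNumber_zero]
    ring
  · norm_num

end Euler

theorem corollary4 (p : ℕ) (hp : p.Prime) (hodd : Odd p) :
    RatModEq p (∑ j ∈ Finset.Icc 0 p, (p : ℚ) * bernoulli j) (-1) ∧
    (5 ≤ p → RatModEq p (∑ j ∈ Finset.Icc 0 (p - 3), bernoulli j) (-1)) ∧
    RatModEq p (∑ j ∈ Finset.Icc 0 p, eulerNumber j) (3 / 2) ∧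
    RatModEq p ((p : ℚ) * ∑ j ∈ Finset.Icc 0 p, bernoulli j / ((p : ℚ) - (j : ℚ) + 1)) (-1) := by
  have : Fact p.Prime := ⟨hp⟩
  simp only [← Nat.range_succ_eq_Icc_zero]
  refine ⟨ratModEq_sum_prime_mul_bernoulli hodd, fun h5 ↦ ?_, ratModEq_sum_eulerNumber hodd,
    ratModEq_prime_mul_sum_bernoulli_div hodd⟩
  have := ratModEq_sum_bernoulli h5 hodd
  rwa [show p - 2 = p - 3 + 1 by omega] at this
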